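/- Let $d\ge 0$ and let $H=H(p,x):\mathbb R^d\times\mathbb R^d\to\mathbb R$ be convex in $p$ for every $x$ and Lipschitz continuous in $p$ uniformly in $x$, i.e. there is $L\ge 0$ with $|H(p,x)-H(q,x)|\le L|p-q|$ for all $p,q,x$. Assume also the usual structure condition on the $x$-dependence: for every $\varepsilon>0$ there is $\delta>0$ such that $|H(p,x)-H(p,y)|<\varepsilon$ whenever $|x-y|\,(1+|p|)<\delta$. For $G=\pm H$, $a>0$ and $u,w:\mathbb R^d\to\mathbb R$ write $w=S_G(a)u$ if $w=U(\cdot,a)$ for a bounded uniformly continuous function $U$ on $\mathbb R^d\times[0,a]$ with $U(\cdot,0)=u$ which is a viscosity solution of $U_t=G(DU,x)$ in $\mathbb R^d\times(0,a)$; that is, for every $\varphi\in C^1(\mathbb R^d\times\mathbb R)$, $\varphi_t\le G(D\varphi,x)$ at every local maximum point $(x,t)\in\mathbb R^d\times(0,a)$ of $U-\varphi$, and $\varphi_t\ge G(D\varphi,x)$ at every local minimum point $(x,t)\in\mathbb R^d\times(0,a)$ of $U-\varphi$. Then, for every bounded uniformly continuous $u:\mathbb R^d\to\mathbb R$ and every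 $a>0$, $$S_H(a)\,S_{-H}(a)\,u\ \le\ u\ \le\ S_{-H}(a)\,S_H(a)\,u\qquad\text{on }\mathbb R^d .$$ Precisely: if $v=S_{-H}(a)u$ and $w=S_H(a)v$, then $w\le u$; and if $v=S_H(a)u$ and $w=S_{-H}(a)v$, then $u\le w$. -/

import Mathlib

open Set Topology

/-- Euclidean space `ℝ^d`. -/
abbrev RSpace (d : ℕ) : Type := EuclideanSpace ℝ (Fin d)

/-- `f` belongs to `BUC(s)`: it is bounded and uniformly continuous on `s`. -/
def IsBUCOn {X : Type*} [UniformSpace X] (f : X → ℝ) (s : Set X) : Prop :=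
  UniformContinuousOn f s ∧ ∃ C : ℝ, ∀ z ∈ s, |f z| ≤ C

/-- `U` is a viscosity subsolution of `u_t = H(Du, x)` in `ℝ^d × (0, T)`: whenever `φ` is `C¹` and
`U - φ` has a local maximum at `(x, t)`, one has `φ_t ≤ H(Dφ, x)` at `(x, t)`. -/
def IsViscositySubsolution {d : ℕ} (H : RSpace d → RSpace d → ℝ) (T : ℝ)
    (U : RSpace d × ℝ → ℝ) : Prop :=
  ∀ φ : RSpace d × ℝ → ℝ, ContDiff ℝ 1 φ → ∀ (x : RSpace d) (t : ℝ), t ∈ Ioo 0 T →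
    IsLocalMax (fun z => U z - φ z) (x, t) →
      deriv (fun s => φ (x, s)) t ≤ H (gradient (fun y => φ (y, t)) x) x

/-- `U` is a viscosity supersolution of `u_t = H(Du, x)` in `ℝ^d × (0, T)`: whenever `φ` is `C¹`
and `U - φ` has a local minimum at `(x, t)`, one has `φ_t ≥ H(Dφ, x)` at `(x, t)`. -/
def IsViscositySupersolution {d : ℕ} (H : RSpace d → RSpace d → ℝ) (T : ℝ)
    (U : RSpace d × ℝ → ℝ) : Prop :=
  ∀ φ : RSpace d × ℝ → ℝ, ContDiff ℝ 1 φ → ∀ (x : RSpace d) (t : ℝ), t ∈ Ioo 0 T →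
    IsLocalMin (fun z => U z - φ z) (x, t) →
      H (gradient (fun y => φ (y, t)) x) x ≤ deriv (fun s => φ (x, s)) t

/-- `U ∈ BUC(ℝ^d × [0, T])` is a viscosity solution of the initial value problem
`u_t = H(Du, x)` in `ℝ^d × (0, T)`, `u(·, 0) = u₀`.
Only the values of `U` on `ℝ^d × [0, T]` matter. -/
structure IsBUCViscositySolution {d : ℕ} (H : RSpace d → RSpace d → ℝ) (T : ℝ)
    (u₀ : RSpace d → ℝ) (U : RSpace d × ℝ → ℝ) : Prop where
  buc : IsBUCOn U (univ ×ˢ Icc 0 T)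
  sub : IsViscositySubsolution H T U
  super : IsViscositySupersolution H T U
  initial : ∀ x, U (x, 0) = u₀ x

/-- The graph of the solution operator `S_H(a)`: `w = S_H(a) u` if `w` is the value at time `a` of
a viscosity solution in `BUC(ℝ^d × [0, a])` of `u_t = H(Du, x)` with initial datum `u`. -/
def IsSolutionOperatorValue {d : ℕ} (H : RSpace d → RSpace d → ℝ) (a : ℝ)
    (u w : RSpace d → ℝ) : Prop :=
  ∃ U : RSpace d × ℝ → ℝ, IsBUCViscositySolution H a u U ∧ ∀ x, U (x, a) = w x

/-- The structure condition on the `x`-dependence of the Hamiltonian, in `ε`-`δ` form: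
`|H(p, x) - H(p, y)| ≤ ω(|x - y| (1 + |p|))` for a modulus of continuity `ω`. -/
def HasStructureModulus {d : ℕ} (H : RSpace d → RSpace d → ℝ) : Prop :=
  ∀ ε : ℝ, 0 < ε → ∃ δ : ℝ, 0 < δ ∧ ∀ p x y : RSpace d,
    ‖x - y‖ * (1 + ‖p‖) < δ → |H p x - H p y| < ε

/-! If `U` solves `U_t = -H(DU, x)`, its time reversal `Y(x, t) = U(x, a - t)` satisfies `φ_t ≥
H(Dφ, x)` where `Y - φ` has a local maximum: a supersolution inequality, but tested from the wrong
side. Convexity of `H` in `p` repairs this. The sup-convolution of `Y` is Lipschitz and inherits the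
inequality, up to a small error, at its points of differentiability, hence almost everywhere.
Mollifying averages the gradients, and by Jensen the average still satisfies the inequality
approximately (`exists_contDiff_supersolution`). So `Y` is a uniform limit of `C¹` approximate
supersolutions `W`. The forward solution `Z` starting from `Y(·, 0) = U(·, a)` can be compared with
`W` directly, since `W` plus a penalty is an admissible test function and no doubling of variables
is needed (`IsViscositySubsolution.le_of_contDiff`). At time `a` this gives `Z ≤ Y(·, a) = u`. The
other inequality is the first one applied to `-U`, `-Z` and the Hamiltonian `H(-p, x)`, which is
again convex. -/

/-! ### Mollification and Jensen's inequality -/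

open MeasureTheory in
/-- Mollification of a Lipschitz function: the derivatives of the smooth approximation are averages
of the derivatives of the function. -/
theorem LipschitzWith.exists_contDiff_fderiv_mem {E : Type*} [NormedAddCommGroup E]
    [NormedSpace ℝ E] [FiniteDimensional ℝ E] [MeasurableSpace E] [BorelSpace E]
    {f : E → ℝ} {K : NNReal} (hf : LipschitzWith K f) {r : ℝ} (hr : 0 < r) :
    ∃ W : E → ℝ, ContDiff ℝ 1 W ∧ (∀ z, |W z - f z| ≤ K * r) ∧
      ∀ (z : E) (S : Set (E →L[ℝ] ℝ)), Convex ℝ S → IsClosed S →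
        (∀ z', ‖z' - z‖ < r → DifferentiableAt ℝ f z' → fderiv ℝ f z' ∈ S) →
        fderiv ℝ W z ∈ S := by
  let μ : Measure E := Measure.addHaar
  let ρ : ContDiffBump (0 : E) := ⟨r / 2, r, by positivity, by linarith⟩
  have hρc : Continuous (ρ.normed μ) := (ρ.contDiff_normed (n := 0)).continuous
  -- With the bump as the density of a probability measure, convolution becomes an average.
  let ν : Measure E := μ.withDensity (fun ζ => ENNReal.ofReal (ρ.normed μ ζ))
  have hden : Measurable (fun ζ => ENNReal.ofReal (ρ.normed μ ζ)) :=
    hρc.measurable.ennreal_ofReal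
  have hνμ : ν ≪ μ := withDensity_absolutelyContinuous _ _
  have hprob : IsProbabilityMeasure ν := by
    constructor
    rw [withDensity_apply _ MeasurableSet.univ, Measure.restrict_univ,
      ← ofReal_integral_eq_lintegral_ofReal ρ.integrable_normed
        (Filter.Eventually.of_forall fun x => ρ.nonneg_normed x), ρ.integral_normed]
    simp
  have hball : ∀ᵐ ζ ∂ν, ‖ζ‖ < r := by
    rw [ae_withDensity_iff hden]
    refine Filter.Eventually.of_forall fun ζ hζ => ?_
    have h1 : ζ ∈ Function.support (ρ.normed μ) := by
      intro h0
      exact hζ (by simp [h0])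
    rw [ρ.support_normed_eq] at h1
    simpa using h1
  let W : E → ℝ := convolution (ρ.normed μ) f (ContinuousLinearMap.lsmul ℝ ℝ) μ
  have hW : ∀ z, W z = ∫ ζ, f (z - ζ) ∂ν := by
    intro z
    rw [integral_withDensity_eq_integral_toReal_smul hden
      (Filter.Eventually.of_forall fun _ => ENNReal.ofReal_lt_top)]
    refine integral_congr_ae (Filter.Eventually.of_forall fun ζ => ?_)
    simp [ENNReal.toReal_ofReal (ρ.nonneg_normed ζ)]
  have hfc := hf.continuous
  refine ⟨W, ?_, ?_, ?_⟩
  · exact ρ.hasCompactSupport_normed.contDiff_convolution_left _ ρ.contDiff_normed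
      hfc.locallyIntegrable
  · intro z
    have := ρ.dist_normed_convolution_le (μ := μ) (g := f) (x₀ := z) (ε := K * r)
      hfc.aestronglyMeasurable (fun x hx => (hf.dist_le_mul x z).trans
        (mul_le_mul_of_nonneg_left (le_of_lt hx) K.2))
    rwa [Real.dist_eq] at this
  · intro z S hS hSc hmem
    -- Rademacher's theorem, transported by `ζ ↦ z - ζ`.
    have hdiff : ∀ᵐ ζ ∂ν, DifferentiableAt ℝ f (z - ζ) :=
      hνμ.ae_le ((quasiMeasurePreserving_sub_left μ z).ae hf.ae_differentiableAt)
    have hmeas : AEStronglyMeasurable (fun ζ => fderiv ℝ f (z - ζ)) ν :=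
      ((measurable_fderiv ℝ f).comp (measurable_const.sub measurable_id)).aestronglyMeasurable
    have hbound : ∀ z, ‖fderiv ℝ f z‖ ≤ K := fun z => norm_fderiv_le_of_lipschitz ℝ hf
    have hint : Integrable (fun ζ => fderiv ℝ f (z - ζ)) ν :=
      Integrable.of_bound hmeas K (Filter.Eventually.of_forall fun ζ => hbound _)
    have hfint : Integrable (fun ζ => f (z - ζ)) ν := by
      refine Integrable.of_bound (C := |f z| + K * r)
        (hfc.comp (continuous_const.sub continuous_id)).aestronglyMeasurable ?_
      filter_upwards [hball] with ζ hζ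
      have h1 := hf.dist_le_mul (z - ζ) z
      rw [Real.dist_eq, dist_eq_norm, sub_sub_cancel_left, norm_neg] at h1
      have h2 : (K : ℝ) * ‖ζ‖ ≤ K * r := mul_le_mul_of_nonneg_left hζ.le K.2
      have h3 := abs_sub_abs_le_abs_sub (f (z - ζ)) (f z)
      rw [Real.norm_eq_abs]
      linarith
    have key := (hasFDerivAt_integral_of_dominated_loc_of_lip (𝕜 := ℝ) (μ := ν)
      (F := fun z ζ => f (z - ζ)) (F' := fun ζ => fderiv ℝ f (z - ζ)) (x₀ := z)
      (s := univ) (bound := fun _ => (K : ℝ)) Filter.univ_mem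
      (Filter.Eventually.of_forall fun y =>
        (hfc.comp (continuous_const.sub continuous_id)).aestronglyMeasurable)
      hfint hmeas
      (Filter.Eventually.of_forall fun ζ => by
        refine LipschitzWith.lipschitzOnWith ?_
        refine LipschitzWith.of_dist_le_mul fun x y => ?_
        have := hf.dist_le_mul (x - ζ) (y - ζ)
        simpa [dist_sub_right] using this)
      (integrable_const _)
      (by
        filter_upwards [hdiff] with ζ hζ
        exact (hasFDerivAt_comp_sub ζ).2 hζ.hasFDerivAt))
    have hWf : W = fun z => ∫ ζ, f (z - ζ) ∂ν := funext hW
    rw [hWf, key.2.fderiv]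
    -- Jensen: a probability average of points of a closed convex set stays in the set.
    refine hS.integral_mem hSc ?_ hint
    filter_upwards [hdiff, hball] with ζ h1 h2
    exact hmem _ (by simpa using h2) h1

/-! ### Sup-convolution -/

/-- The squared Euclidean norm on `ℝ^d × ℝ`. -/
noncomputable def sqNorm {d : ℕ} (z : RSpace d × ℝ) : ℝ := ‖z.1‖ ^ 2 + z.2 ^ 2

theorem contDiff_sqNorm {d : ℕ} {n : WithTop ℕ∞} : ContDiff ℝ n (sqNorm (d := d)) :=
  (contDiff_fst.norm_sq ℝ).add (contDiff_snd.pow 2)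

/-- The product carries the sup norm, whose square is not smooth; this lets `sqNorm` control
distances in its place. -/
theorem sq_norm_le_sqNorm {d : ℕ} (z : RSpace d × ℝ) : ‖z‖ ^ 2 ≤ sqNorm z := by
  rw [sqNorm, Prod.norm_def]
  rcases max_cases ‖z.1‖ ‖z.2‖ with h | h
  · rw [h.1]; nlinarith [sq_nonneg z.2]
  · rw [h.1, Real.norm_eq_abs, sq_abs]; nlinarith [sq_nonneg ‖z.1‖]

theorem sqNorm_add_le {d : ℕ} (e h : RSpace d × ℝ) :
    sqNorm (e + h) ≤ sqNorm e + 2 * (2 * ‖e‖ + ‖h‖) * ‖h‖ := by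
  have h1 := norm_add_le e.1 h.1
  have e1 := norm_fst_le e
  have e2 := norm_snd_le e
  have k1 := norm_fst_le h
  have k2 := norm_snd_le h
  have n1 := norm_nonneg e.1
  have n2 := norm_nonneg h.1
  have n3 := norm_nonneg e.2
  have n4 := norm_nonneg h.2
  have h2 : e.2 * h.2 ≤ ‖e‖ * ‖h‖ := by
    refine (le_abs_self _).trans ?_
    rw [abs_mul]
    exact mul_le_mul e2 k2 n4 (norm_nonneg _)
  have h3 : ‖e.1‖ * ‖h.1‖ ≤ ‖e‖ * ‖h‖ := mul_le_mul e1 k1 n2 (norm_nonneg _)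
  have h4 : h.2 ^ 2 ≤ ‖h‖ ^ 2 := by
    rw [← sq_abs]
    exact pow_le_pow_left₀ n4 k2 2
  have h5 : ‖h.1‖ ^ 2 ≤ ‖h‖ ^ 2 := pow_le_pow_left₀ n2 k1 2
  have h6 : ‖e.1 + h.1‖ ^ 2 ≤ (‖e.1‖ + ‖h.1‖) ^ 2 := pow_le_pow_left₀ (norm_nonneg _) h1 2
  simp only [sqNorm, Prod.fst_add, Prod.snd_add]
  nlinarith

/-- The maximum in the sup-convolution is attained. -/
theorem exists_forall_sub_sqNorm_le {d : ℕ} {Y : RSpace d × ℝ → ℝ} (hY : Continuous Y) {C k : ℝ}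
    (hC : ∀ z, |Y z| ≤ C) (hk : 0 < k) (z : RSpace d × ℝ) :
    ∃ y, ∀ ζ, Y ζ - k * sqNorm (z - ζ) ≤ Y y - k * sqNorm (z - y) := by
  have hcont : Continuous fun ζ => Y ζ - k * sqNorm (z - ζ) :=
    hY.sub (continuous_const.mul
      ((contDiff_sqNorm (n := 0)).continuous.comp (continuous_const.sub continuous_id)))
  refine hcont.exists_forall_ge' z ?_
  have hlim : Filter.Tendsto (fun ζ => ‖z - ζ‖) (Filter.cocompact (RSpace d × ℝ)) Filter.atTop :=
    tendsto_norm_cocompact_atTop.comp (Homeomorph.subLeft z).isClosedEmbedding.tendsto_cocompact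
  filter_upwards [hlim.eventually_ge_atTop (1 + 2 * C / k)] with ζ hζ
  have h1 := abs_le.1 (hC ζ)
  have h2 := abs_le.1 (hC z)
  have hC0 : 0 ≤ C := (abs_nonneg _).trans (hC z)
  have h3 := sq_norm_le_sqNorm (z - ζ)
  have h4 : 0 ≤ 2 * C / k := by positivity
  have h5 : 2 * C / k ≤ sqNorm (z - ζ) := by nlinarith
  have h6 : 2 * C ≤ k * sqNorm (z - ζ) := by
    rw [div_le_iff₀ hk] at h5; linarith
  have h7 : sqNorm (z - z) = 0 := by simp [sqNorm]
  rw [h7]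
  linarith

/-- Sup-convolution of a bounded uniformly continuous function: a nearby Lipschitz function whose
gradients are gradients of quadratic test functions touching `Y` from above at nearby points. -/
theorem exists_supConvolution {d : ℕ} {Y : RSpace d × ℝ → ℝ} (hY : UniformContinuous Y) {C : ℝ}
    (hC : ∀ z, |Y z| ≤ C) {η : ℝ} (hη : 0 < η) :
    ∃ (k : ℝ) (K : NNReal) (f : RSpace d × ℝ → ℝ), LipschitzWith K f ∧
      (∀ z, |f z - Y z| ≤ η) ∧ ∀ z, DifferentiableAt ℝ f z → ∃ y, ‖z - y‖ ≤ η ∧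
        0 < k ∧ k * sqNorm (z - y) ≤ η ∧
        (∀ ζ, Y ζ - k * sqNorm (z - ζ) ≤ Y y - k * sqNorm (z - y)) ∧
        fderiv ℝ f z = -(k • fderiv ℝ sqNorm (z - y)) := by
  have hC0 : 0 ≤ C := (abs_nonneg _).trans (hC 0)
  obtain ⟨δ, hδ, hYδ⟩ := Metric.uniformContinuous_iff.1 hY η hη
  set m := min δ η with hm
  have hm0 : 0 < m := lt_min hδ hη
  -- A maximiser `y` has `k * ‖z - y‖ ^ 2 ≤ Y y - Y z ≤ 2 * C < k * m ^ 2`, so it lies within `m` of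
  -- `z`.
  set k := (2 * C + 1) / m ^ 2 with hkdef
  have hk : 0 < k := by positivity
  have hkm : k * m ^ 2 = 2 * C + 1 := by rw [hkdef]; field_simp
  choose y hy using fun z => exists_forall_sub_sqNorm_le hY.continuous hC hk z
  have hzz : ∀ z : RSpace d × ℝ, sqNorm (z - z) = 0 := fun z => by simp [sqNorm]
  have hself : ∀ z, k * sqNorm (z - y z) ≤ Y (y z) - Y z := by
    intro z
    have := hy z z
    rw [hzz] at this
    linarith
  have hdist : ∀ z, ‖z - y z‖ < m := by
    intro z
    have h1 := hself z
    have h2 := abs_le.1 (hC z)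
    have h3 := abs_le.1 (hC (y z))
    have h4 := mul_le_mul_of_nonneg_left (sq_norm_le_sqNorm (z - y z)) hk.le
    refine lt_of_pow_lt_pow_left₀ 2 hm0.le ?_
    refine lt_of_mul_lt_mul_left ?_ hk.le
    linarith
  have hosc : ∀ z, Y (y z) - Y z < η := by
    intro z
    have h1 : dist (y z) z < δ := by
      rw [dist_comm, dist_eq_norm]
      exact (hdist z).trans_le (min_le_left _ _)
    have := hYδ h1
    rw [Real.dist_eq] at this
    exact (le_abs_self _).trans_lt this
  have hsq0 : ∀ z : RSpace d × ℝ, 0 ≤ sqNorm z := fun z => by unfold sqNorm; positivity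
  let f : RSpace d × ℝ → ℝ := fun z => Y (y z) - k * sqNorm (z - y z)
  have hfle : ∀ z ζ, Y ζ - k * sqNorm (z - ζ) ≤ f z := hy
  have hfY : ∀ z, |f z - Y z| ≤ η := by
    intro z
    have h1 := hfle z z
    rw [hzz] at h1
    have h2 := hosc z
    have h3 := mul_nonneg hk.le (hsq0 (z - y z))
    rw [abs_le]
    constructor
    · linarith
    · change Y (y z) - k * sqNorm (z - y z) - Y z ≤ η
      linarith
  -- The first summand serves points at distance at most 1, the second, from `|f| ≤ C + η`, points
  -- further apart.
  set K : NNReal := ⟨k * (2 * (2 * η + 1)) + 2 * (C + η), by positivity⟩ with hK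
  have hKval : (K : ℝ) = k * (2 * (2 * η + 1)) + 2 * (C + η) := rfl
  have hlip : LipschitzWith K f := by
    refine LipschitzWith.of_le_add_mul K fun z z' => ?_
    rw [hKval, dist_eq_norm]
    have hn := norm_nonneg (z - z')
    rcases le_or_gt ‖z - z'‖ 1 with h | h
    · have h1 := hfle z' (y z)
      have h2 := sqNorm_add_le (z - y z) (z' - z)
      rw [sub_add_sub_comm, add_comm z z', sub_add_eq_sub_sub_swap, add_sub_cancel_right,
        norm_sub_rev z' z] at h2
      have h3 := (hdist z).le.trans (min_le_right _ _)
      have h4 : 2 * (2 * ‖z - y z‖ + ‖z - z'‖) * ‖z - z'‖ ≤ 2 * (2 * η + 1) * ‖z - z'‖ := by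
        gcongr
      have h5 : k * sqNorm (z' - y z) ≤
          k * sqNorm (z - y z) + k * (2 * (2 * η + 1)) * ‖z - z'‖ := by
        rw [mul_assoc k, ← mul_add]
        exact mul_le_mul_of_nonneg_left (by linarith) hk.le
      have h6 : 0 ≤ 2 * (C + η) * ‖z - z'‖ := by positivity
      change Y (y z) - k * sqNorm (z - y z) ≤ _
      linarith
    · have h1 := abs_le.1 (hfY z)
      have h2 := abs_le.1 (hfY z')
      have h3 := abs_le.1 (hC z)
      have h4 := abs_le.1 (hC z')
      have h5 : 2 * (C + η) * 1 ≤ 2 * (C + η) * ‖z - z'‖ := by gcongr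
      have h6 : 0 ≤ k * (2 * (2 * η + 1)) * ‖z - z'‖ := by positivity
      linarith
  refine ⟨k, K, f, hlip, hfY, fun z hz => ⟨y z, ?_, hk, ?_, hy z, ?_⟩⟩
  · exact (hdist z).le.trans (min_le_right _ _)
  · exact (hself z).trans (hosc z).le
  · have hq : HasFDerivAt (fun z' => k * sqNorm (z' - y z))
        (k • fderiv ℝ sqNorm (z - y z)) z :=
      ((hasFDerivAt_comp_sub (y z)).2 ((contDiff_sqNorm (n := 1)).differentiable one_ne_zero
        (z - y z)).hasFDerivAt).const_mul k
    -- With the maximiser `y z` frozen, the paraboloid touches `f` from below at `z`, so the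
    -- derivatives agree there.
    have hmin : IsLocalMin (fun z' => f z' + k * sqNorm (z' - y z)) z := by
      refine Filter.Eventually.of_forall fun z' => ?_
      have h1 := hfle z' (y z)
      change Y (y z) - k * sqNorm (z - y z) + k * sqNorm (z - y z) ≤ _
      linarith
    exact eq_neg_of_add_eq_zero_left (hmin.hasFDerivAt_eq_zero (hz.hasFDerivAt.add hq))

/-! ### Derivatives in space and time -/

/-- The spatial gradient corresponding to a derivative on `ℝ^d × ℝ`. -/
noncomputable def spatialGradient {d : ℕ} : (RSpace d × ℝ →L[ℝ] ℝ) →ₗ[ℝ] RSpace d where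
  toFun D := (InnerProductSpace.toDual ℝ (RSpace d)).symm
    (D.comp (ContinuousLinearMap.inl ℝ (RSpace d) ℝ))
  map_add' D D' := by rw [ContinuousLinearMap.add_comp, map_add]
  map_smul' c D := by simp [ContinuousLinearMap.smul_comp]

theorem norm_spatialGradient_le {d : ℕ} (D : RSpace d × ℝ →L[ℝ] ℝ) :
    ‖spatialGradient D‖ ≤ ‖D‖ := by
  change ‖(InnerProductSpace.toDual ℝ (RSpace d)).symm _‖ ≤ _
  rw [LinearIsometryEquiv.norm_map]
  calc _ ≤ ‖D‖ * ‖ContinuousLinearMap.inl ℝ (RSpace d) ℝ‖ := D.opNorm_comp_le _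
    _ ≤ ‖D‖ * 1 := by
        gcongr
        exact ContinuousLinearMap.norm_inl_le_one ℝ (RSpace d) ℝ
    _ = ‖D‖ := mul_one _

theorem HasFDerivAt.gradient_slice {d : ℕ} {φ : RSpace d × ℝ → ℝ} {D : RSpace d × ℝ →L[ℝ] ℝ}
    {x : RSpace d} {t : ℝ} (h : HasFDerivAt φ D (x, t)) :
    gradient (fun y => φ (y, t)) x = spatialGradient D := by
  have h1 : HasFDerivAt (fun y => φ (y, t)) (D.comp (ContinuousLinearMap.inl ℝ (RSpace d) ℝ)) x :=
    HasFDerivAt.comp (f := fun y => (y, t)) x h (hasFDerivAt_prodMk_left x t)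
  rw [gradient, h1.fderiv]
  rfl

theorem HasFDerivAt.deriv_slice {d : ℕ} {φ : RSpace d × ℝ → ℝ} {D : RSpace d × ℝ →L[ℝ] ℝ}
    {x : RSpace d} {t : ℝ} (h : HasFDerivAt φ D (x, t)) :
    deriv (fun s => φ (x, s)) t = D (0, 1) := by
  have h1 : HasFDerivAt (fun s => φ (x, s)) (D.comp (ContinuousLinearMap.inr ℝ (RSpace d) ℝ)) t :=
    HasFDerivAt.comp (f := fun s => (x, s)) t h (hasFDerivAt_prodMk_right x t)
  rw [h1.hasDerivAt.deriv]
  simp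

theorem norm_spatialGradient_fderiv_sqNorm {d : ℕ} (e : RSpace d × ℝ) :
    ‖spatialGradient (fderiv ℝ sqNorm e)‖ = 2 * ‖e.1‖ := by
  have h := ((contDiff_sqNorm (d := d) (n := 1)).differentiable one_ne_zero e).hasFDerivAt
  rw [← HasFDerivAt.gradient_slice (x := e.1) (t := e.2) h]
  have h2 : HasGradientAt (fun y : RSpace d => sqNorm (y, e.2)) ((2 : ℝ) • e.1) e.1 := by
    rw [hasGradientAt_iff_hasFDerivAt]
    have h3 := (hasStrictFDerivAt_norm_sq e.1).hasFDerivAt.add_const (e.2 ^ 2)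
    refine h3.congr_fderiv ?_
    ext v
    simp
  rw [h2.gradient, norm_smul]
  simp

/-! ### Smooth approximate supersolutions -/

/-- If `Y` satisfies `H(DY, x) ≤ Y_t` at local maxima of `Y - φ` and `H` is convex in `p`, then `Y`
is a uniform limit of classical approximate supersolutions. -/
theorem exists_contDiff_supersolution {d : ℕ} {H : RSpace d → RSpace d → ℝ}
    (hconv : ∀ x : RSpace d, ConvexOn ℝ Set.univ (fun p => H p x)) {L : NNReal}
    (hlip : ∀ x : RSpace d, LipschitzWith L (fun p => H p x))
    (hmod : HasStructureModulus H) {Y : RSpace d × ℝ → ℝ} (hY : UniformContinuous Y) {C : ℝ}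
    (hC : ∀ z, |Y z| ≤ C) {a : ℝ}
    (hsup : ∀ φ : RSpace d × ℝ → ℝ, ContDiff ℝ 1 φ → ∀ (x : RSpace d) (t : ℝ), t ∈ Ioo 0 a →
      IsLocalMax (fun z => Y z - φ z) (x, t) →
        H (gradient (fun y => φ (y, t)) x) x ≤ deriv (fun s => φ (x, s)) t)
    {σ θ : ℝ} (hσ : 0 < σ) (hθ : 0 < θ) :
    ∃ W : RSpace d × ℝ → ℝ, ContDiff ℝ 1 W ∧ (∀ z, |W z - Y z| ≤ σ) ∧
      ∀ x t, t ∈ Ioo θ (a - θ) →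
        H (spatialGradient (fderiv ℝ W (x, t))) x ≤ fderiv ℝ W (x, t) (0, 1) + σ := by
  obtain ⟨δ, hδ, hHδ⟩ := hmod (σ / 2) (by positivity)
  -- `θ / 4` keeps the touching point inside the time interval; `δ / 4` suffices since `‖x - y‖ * (1
  -- + ‖p‖) = ‖x - y‖ + 2 * k * ‖x - y‖ ^ 2 ≤ 3 * η < δ`.
  set η := min (σ / 2) (min (θ / 4) (δ / 4)) with hη
  have hη0 : 0 < η := by positivity
  have hησ : η ≤ σ / 2 := min_le_left _ _
  have hηθ : η ≤ θ / 4 := (min_le_right _ _).trans (min_le_left _ _)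
  have hηδ : η ≤ δ / 4 := (min_le_right _ _).trans (min_le_right _ _)
  obtain ⟨k, K, f, hfK, hfY, hfd⟩ := exists_supConvolution hY hC hη0
  have hf : ∀ z, z.2 ∈ Ioo (θ / 2) (a - θ / 2) → DifferentiableAt ℝ f z →
      H (spatialGradient (fderiv ℝ f z)) z.1 ≤ fderiv ℝ f z (0, 1) + σ / 2 := by
    intro z hz hdz
    obtain ⟨y, hzy, hk, hky, hmax, hD⟩ := hfd z hdz
    have hy2 := abs_le.1 ((norm_snd_le (z - y)).trans hzy)
    rw [Prod.snd_sub] at hy2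
    -- This paraboloid touches `Y` from above at `y`, up to a constant, with derivative `fderiv ℝ f
    -- z`; the structure condition then moves `H` from `y.1` to `z.1`.
    have hφ : ContDiff ℝ 1 (fun ζ => k * sqNorm (z - ζ)) :=
      contDiff_const.mul (contDiff_sqNorm.comp (contDiff_const.sub contDiff_id))
    have hφd : HasFDerivAt (fun ζ => k * sqNorm (z - ζ)) (fderiv ℝ f z) (y.1, y.2) := by
      rw [hD]
      have h1 := ((contDiff_sqNorm (d := d) (n := 1)).differentiable one_ne_zero
        (z - y)).hasFDerivAt
      have h2 : HasFDerivAt (fun ζ => z - ζ)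
          (-ContinuousLinearMap.id ℝ (RSpace d × ℝ)) y := (hasFDerivAt_id y).const_sub z
      refine ((HasFDerivAt.comp y h1 h2).const_mul k).congr_fderiv ?_
      ext v <;> simp
    have h1 := hsup _ hφ y.1 y.2 ⟨by linarith [hz.1], by linarith [hz.2]⟩
      (Filter.Eventually.of_forall hmax)
    rw [hφd.gradient_slice, hφd.deriv_slice] at h1
    have hx : ‖z.1 - y.1‖ ≤ ‖z - y‖ := norm_fst_le (z - y)
    have hp : ‖spatialGradient (fderiv ℝ f z)‖ = k * (2 * ‖z.1 - y.1‖) := by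
      rw [hD, map_neg, map_smul, norm_neg, norm_smul, norm_spatialGradient_fderiv_sqNorm,
        Real.norm_of_nonneg hk.le, Prod.fst_sub]
    have hq : k * ‖z.1 - y.1‖ ^ 2 ≤ η := by
      refine le_trans ?_ hky
      gcongr
      simp only [sqNorm, Prod.fst_sub]
      linarith [sq_nonneg (z - y).2]
    have h2 := hHδ (spatialGradient (fderiv ℝ f z)) z.1 y.1 (by
      rw [hp]
      nlinarith)
    linarith [(abs_lt.1 h2).2]
  -- As gradients of `f` are bounded by `K`, the bound on `r * (1 + K)` controls both the
  -- mollification error and the cost of freezing `x` in `H`.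
  set r := min (θ / 2) (min (σ / 2) (δ / 2) / (1 + K)) with hr
  have hr0 : 0 < r := by positivity
  have hrθ : r ≤ θ / 2 := min_le_left _ _
  have hrK : r * (1 + K) ≤ min (σ / 2) (δ / 2) :=
    (le_div_iff₀ (by positivity)).1 (min_le_right _ _)
  have hrσ := hrK.trans (min_le_left _ _)
  have hrδ := hrK.trans (min_le_right _ _)
  obtain ⟨W, hW, hWf, hWD⟩ := hfK.exists_contDiff_fderiv_mem hr0
  refine ⟨W, hW, fun z => ?_, fun x t ht => ?_⟩
  · have h1 := abs_le.1 (hWf z)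
    have h2 := abs_le.1 (hfY z)
    rw [abs_le]
    constructor <;> linarith
  · have hsg : Continuous (spatialGradient (d := d)) := spatialGradient.continuous_of_finiteDimensional
    have hev : Continuous fun D : RSpace d × ℝ →L[ℝ] ℝ => D (0, 1) :=
      (ContinuousLinearMap.apply ℝ ℝ ((0, 1) : RSpace d × ℝ)).continuous
    refine hWD (x, t) {D | H (spatialGradient D) x ≤ D (0, 1) + σ} ?_ ?_ ?_
    · have h1 : ConvexOn ℝ univ fun D : RSpace d × ℝ →L[ℝ] ℝ => H (spatialGradient D) x :=
        (hconv x).comp_linearMap spatialGradient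
      intro D hD D' hD' s s' hs hs' hss
      have h2 := h1.2 (mem_univ D) (mem_univ D') hs hs' hss
      simp only [mem_ofPred_eq, smul_eq_mul] at h2 hD hD' ⊢
      have e1 := mul_le_mul_of_nonneg_left hD hs
      have e2 := mul_le_mul_of_nonneg_left hD' hs'
      have e3 : s * σ + s' * σ = σ := by rw [← add_mul, hss, one_mul]
      have e4 : (s • D + s' • D') (0, 1) = s * D (0, 1) + s' * D' (0, 1) := by simp
      rw [e4]
      linarith
    · exact isClosed_le ((hlip x).continuous.comp hsg) (hev.add continuous_const)
    · intro z hz hdz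
      have hz1 : ‖z.1 - x‖ ≤ ‖z - (x, t)‖ := norm_fst_le (z - (x, t))
      have hz2 := abs_le.1 ((norm_snd_le (z - (x, t))).trans hz.le)
      rw [Prod.snd_sub] at hz2
      dsimp only at hz2
      have h1 := hf z ⟨by linarith [ht.1], by linarith [ht.2]⟩ hdz
      have hp : ‖spatialGradient (fderiv ℝ f z)‖ ≤ K :=
        (norm_spatialGradient_le _).trans (norm_fderiv_le_of_lipschitz ℝ hfK)
      have h2 := hHδ (spatialGradient (fderiv ℝ f z)) x z.1 (by
        calc ‖x - z.1‖ * (1 + ‖spatialGradient (fderiv ℝ f z)‖) ≤ r * (1 + K) := by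
              rw [norm_sub_rev]
              gcongr
              exact hz1.trans hz.le
          _ < δ := by linarith)
      rw [mem_ofPred_eq]
      linarith [(abs_lt.1 h2).2]

/-! ### Comparison with a smooth supersolution -/

/-- This smooth coercive function with gradient at most 1 is the penalty that forces maxima to exist
on the unbounded space. -/
theorem lipschitzWith_sqrt_one_add_norm_sq {d : ℕ} :
    LipschitzWith 1 fun x : RSpace d => √(1 + ‖x‖ ^ 2) := by
  refine LipschitzWith.of_le_add fun x y => ?_
  have h1 : ‖x‖ ≤ ‖y‖ + dist x y := by
    rw [dist_eq_norm]
    exact norm_le_norm_add_norm_sub' x y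
  have h2 : ‖y‖ ≤ √(1 + ‖y‖ ^ 2) := Real.le_sqrt_of_sq_le (by linarith)
  have h3 := Real.sq_sqrt (show 0 ≤ 1 + ‖y‖ ^ 2 by positivity)
  have h4 : 0 ≤ dist x y := dist_nonneg
  have h5 : ‖x‖ ^ 2 ≤ (‖y‖ + dist x y) ^ 2 := pow_le_pow_left₀ (norm_nonneg x) h1 2
  refine Real.sqrt_le_iff.2 ⟨by positivity, ?_⟩
  nlinarith

theorem contDiff_sqrt_one_add_norm_sq {d : ℕ} :
    ContDiff ℝ 1 fun x : RSpace d => √(1 + ‖x‖ ^ 2) :=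
  (contDiff_const.add (contDiff_id.norm_sq ℝ)).sqrt fun x => by positivity

/-- Comparison of a viscosity subsolution with a classical approximate supersolution. -/
theorem IsViscositySubsolution.le_of_contDiff {d : ℕ} {H : RSpace d → RSpace d → ℝ} {L : NNReal}
    (hlip : ∀ x : RSpace d, LipschitzWith L (fun p => H p x)) {a : ℝ} {Z W : RSpace d × ℝ → ℝ}
    (hZ : IsViscositySubsolution H a Z) {θ b κ m C : ℝ} (hθ : 0 < θ) (hb : b < a)
    (hκ : 0 ≤ κ)
    (hZc : ContinuousOn Z (univ ×ˢ Icc θ b)) (hZW : ∀ z ∈ univ ×ˢ Icc θ b, Z z - W z ≤ C)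
    (hW : ContDiff ℝ 1 W)
    (hWH : ∀ x t, t ∈ Ioo θ b →
      H (spatialGradient (fderiv ℝ W (x, t))) x ≤ fderiv ℝ W (x, t) (0, 1) + κ)
    (hinit : ∀ x, Z (x, θ) ≤ W (x, θ) + m) (x₁ : RSpace d) {t₁ : ℝ} (ht₁ : t₁ ∈ Ico θ b) :
    Z (x₁, t₁) ≤ W (x₁, t₁) + m + κ * (t₁ - θ) := by
  by_contra! hcon
  set g := Z (x₁, t₁) - (W (x₁, t₁) + m + κ * (t₁ - θ)) with hg
  have hg0 : 0 < g := by linarith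
  set P := √(1 + ‖x₁‖ ^ 2) + (L + 1) * (t₁ - θ) + 1 with hP
  have ht₁θ : 0 ≤ t₁ - θ := by linarith [ht₁.1]
  have hP0 : 0 < P := by positivity
  set μ := g / (2 * P) with hμ
  have hμ0 : 0 < μ := by positivity
  have hμP : μ * P < g := by
    have : μ * P = g / 2 := by rw [hμ]; field_simp
    linarith
  have hexp : Filter.Tendsto (fun N : ℝ => Real.exp (N * (b - t₁))) Filter.atTop Filter.atTop :=
    Real.tendsto_exp_atTop.comp
      (Filter.tendsto_id.atTop_mul_const (by linarith [ht₁.2]))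
  -- The exponential in `ψ` contributes only `μ` at `t₁` but more than `C - m` at `b`, so the
  -- maximum cannot sit at the final time.
  obtain ⟨N, hN, hN0⟩ := ((hexp.eventually_gt_atTop ((C - m) / μ)).and
    (Filter.eventually_ge_atTop 0)).exists
  rw [div_lt_iff₀ hμ0] at hN
  -- The spatial penalty has gradient at most `μ` and changes `H` by at most `L * μ`; the time slope
  -- `μ * (L + 1)` exceeds this by `μ`, which is the final contradiction.
  let ψ : RSpace d × ℝ → ℝ := fun z =>
    μ * √(1 + ‖z.1‖ ^ 2) + ((m + κ * (z.2 - θ)) + (μ * (L + 1)) * (z.2 - θ)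
      + μ * Real.exp (N * (z.2 - t₁)))
  have hψ : ContDiff ℝ 1 ψ := by
    have h1 : ContDiff ℝ 1 fun z : RSpace d × ℝ => √(1 + ‖z.1‖ ^ 2) :=
      contDiff_sqrt_one_add_norm_sq.comp contDiff_fst
    fun_prop
  let φ : RSpace d × ℝ → ℝ := fun z => W z + ψ z
  have hφ : ContDiff ℝ 1 φ := hW.add hψ
  have hclosed : IsClosed ((univ : Set (RSpace d)) ×ˢ Icc θ b) := isClosed_univ.prod isClosed_Icc
  have hmem₁ : (x₁, t₁) ∈ (univ : Set (RSpace d)) ×ˢ Icc θ b := ⟨mem_univ _, ht₁.1, ht₁.2.le⟩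
  have hpos : 0 < Z (x₁, t₁) - φ (x₁, t₁) := by
    have : φ (x₁, t₁) = W (x₁, t₁) + m + κ * (t₁ - θ) + μ * P := by
      simp only [φ, ψ, hP, sub_self, mul_zero, Real.exp_zero]
      ring
    rw [this]
    linarith
  have hψge : ∀ z ∈ (univ : Set (RSpace d)) ×ˢ Icc θ b,
      m + μ * ‖z‖ - μ * (|θ| + |b|) ≤ ψ z := by
    rintro ⟨x, t⟩ ⟨-, ht⟩
    have h1 : ‖x‖ ≤ √(1 + ‖x‖ ^ 2) := Real.le_sqrt_of_sq_le (by linarith)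
    have h2 : ‖(x, t)‖ ≤ ‖x‖ + (|θ| + |b|) := by
      rw [Prod.norm_def]
      refine max_le (by simp only; linarith [abs_nonneg θ, abs_nonneg b]) ?_
      simp only [Real.norm_eq_abs]
      have := abs_le_max_abs_abs ht.1 ht.2
      linarith [norm_nonneg x, max_le_add_of_nonneg (abs_nonneg θ) (abs_nonneg b)]
    have h3 : 0 ≤ κ * (t - θ) := mul_nonneg hκ (by linarith [ht.1])
    have h4 : 0 ≤ (μ * (L + 1)) * (t - θ) := mul_nonneg (by positivity) (by linarith [ht.1])
    have h5 : 0 < μ * Real.exp (N * (t - t₁)) := by positivity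
    have h6 := mul_le_mul_of_nonneg_left (h2.trans (add_le_add_left h1 _)) hμ0.le
    simp only [ψ]
    linarith
  obtain ⟨⟨x₀, t₀⟩, hz₀, hmax⟩ := ContinuousOn.exists_isMaxOn' (f := fun z => Z z - φ z)
    (hZc.sub hφ.continuous.continuousOn) hclosed hmem₁ (by
      rw [Filter.eventually_inf_principal]
      filter_upwards [tendsto_norm_cocompact_atTop.eventually_ge_atTop
        ((C - m) / μ + (|θ| + |b|))] with z hz hzs
      have h1 := hψge z hzs
      have h2 := hZW z hzs
      have h3 : C - m ≤ μ * (‖z‖ - (|θ| + |b|)) := by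
        rw [mul_comm, ← div_le_iff₀ hμ0]
        linarith
      change Z z - (W z + ψ z) ≤ _
      linarith)
  have hpos₀ : 0 < Z (x₀, t₀) - φ (x₀, t₀) := hpos.trans_le (hmax hmem₁)
  have hψ₀ : m + κ * (t₀ - θ) + (μ * (L + 1)) * (t₀ - θ) + μ * Real.exp (N * (t₀ - t₁))
      < ψ (x₀, t₀) := by
    have : 0 < μ * √(1 + ‖x₀‖ ^ 2) := by positivity
    simp only [ψ]
    linarith
  have hφ₀ : φ (x₀, t₀) = W (x₀, t₀) + ψ (x₀, t₀) := rfl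
  have ht₀ : t₀ ∈ Icc θ b := hz₀.2
  have e1 : 0 ≤ κ * (t₀ - θ) := mul_nonneg hκ (by linarith [ht₀.1])
  have e2 : 0 ≤ (μ * (L + 1)) * (t₀ - θ) := mul_nonneg (by positivity) (by linarith [ht₀.1])
  have e3 : 0 < μ * Real.exp (N * (t₀ - t₁)) := by positivity
  have htθ : θ < t₀ := by
    refine lt_of_le_of_ne ht₀.1 fun h => ?_
    subst h
    linarith [hinit x₀]
  have htb : t₀ < b := by
    refine lt_of_le_of_ne ht₀.2 fun h => ?_
    have h1 := hZW _ hz₀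
    rw [h] at h1 hψ₀ hφ₀ hpos₀ e1 e2
    linarith
  have hloc : IsLocalMax (fun z => Z z - φ z) (x₀, t₀) :=
    hmax.isLocalMax (prod_mem_nhds Filter.univ_mem (Icc_mem_nhds htθ htb))
  have hvis := hZ φ hφ x₀ t₀ ⟨hθ.trans htθ, htb.trans hb⟩ hloc
  have hWd := (hW.differentiable one_ne_zero (x₀, t₀)).hasFDerivAt
  have hψd := (hψ.differentiable one_ne_zero (x₀, t₀)).hasFDerivAt
  have hφd : HasFDerivAt φ (fderiv ℝ W (x₀, t₀) + fderiv ℝ ψ (x₀, t₀)) (x₀, t₀) := hWd.add hψd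
  rw [hφd.gradient_slice, hφd.deriv_slice, map_add, add_apply,
    ← hψd.gradient_slice, ← hψd.deriv_slice] at hvis
  have hgrad : ‖gradient (fun y => ψ (y, t₀)) x₀‖ ≤ μ := by
    rw [gradient, LinearIsometryEquiv.norm_map]
    simp only [ψ]
    rw [fderiv_add_const, fderiv_const_mul
      (contDiff_sqrt_one_add_norm_sq.differentiable one_ne_zero x₀), norm_smul,
      Real.norm_of_nonneg hμ0.le]
    have := norm_fderiv_le_of_lipschitz ℝ (lipschitzWith_sqrt_one_add_norm_sq (d := d)) (x₀ := x₀)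
    calc _ ≤ μ * ((1 : NNReal) : ℝ) := by gcongr
      _ = μ := by simp
  have hder : κ + μ * (L + 1) ≤ deriv (fun s => ψ (x₀, s)) t₀ := by
    have h1 : HasDerivAt (fun s : ℝ => s - θ) 1 t₀ := (hasDerivAt_id t₀).sub_const θ
    have h2 : HasDerivAt (fun s : ℝ => N * (s - t₁)) (N * 1) t₀ :=
      ((hasDerivAt_id t₀).sub_const t₁).const_mul N
    have h3 : HasDerivAt (fun s => ψ (x₀, s))
        (κ * 1 + (μ * (L + 1)) * 1 + μ * (Real.exp (N * (t₀ - t₁)) * (N * 1))) t₀ :=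
      ((((h1.const_mul κ).const_add m).add (h1.const_mul (μ * (L + 1)))).add
        (h2.exp.const_mul μ)).const_add (μ * √(1 + ‖x₀‖ ^ 2))
    rw [h3.deriv]
    have : 0 ≤ μ * (Real.exp (N * (t₀ - t₁)) * (N * 1)) := by positivity
    linarith
  have hHl := (hlip x₀).dist_le_mul (spatialGradient (fderiv ℝ W (x₀, t₀)) +
    gradient (fun y => ψ (y, t₀)) x₀) (spatialGradient (fderiv ℝ W (x₀, t₀)))
  rw [Real.dist_eq, dist_eq_norm, add_sub_cancel_left] at hHl
  have h1 := (le_abs_self _).trans hHl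
  have h2 : (L : ℝ) * ‖gradient (fun y => ψ (y, t₀)) x₀‖ ≤ L * μ := by gcongr
  have h3 := hWH x₀ t₀ ⟨htθ, htb⟩
  linarith

/-! ### Time reversal and the first inequality -/

/-- Time reversal of a viscosity subsolution of `u_t = -H(Du, x)`. -/
theorem IsViscositySubsolution.le_deriv_of_reverse {d : ℕ} {H : RSpace d → RSpace d → ℝ} {a : ℝ}
    {U Y : RSpace d × ℝ → ℝ} (hU : IsViscositySubsolution (fun p x => -H p x) a U)
    (hY : ∀ x, ∀ t ∈ Icc 0 a, Y (x, t) = U (x, a - t)) {φ : RSpace d × ℝ → ℝ}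
    (hφ : ContDiff ℝ 1 φ) {x : RSpace d} {t : ℝ} (ht : t ∈ Ioo 0 a)
    (hmax : IsLocalMax (fun z => Y z - φ z) (x, t)) :
    H (gradient (fun y => φ (y, t)) x) x ≤ deriv (fun s => φ (x, s)) t := by
  have hψ : ContDiff ℝ 1 fun z : RSpace d × ℝ => φ (z.1, a - z.2) :=
    hφ.comp (contDiff_fst.prodMk (contDiff_const.sub contDiff_snd))
  have ht' : a - t ∈ Ioo 0 a := ⟨by linarith [ht.2], by linarith [ht.1]⟩
  have hUY : ∀ y, ∀ s ∈ Icc 0 a, U (y, s) = Y (y, a - s) := fun y s hs => by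
    rw [hY y (a - s) ⟨by linarith [hs.2], by linarith [hs.1]⟩, sub_sub_cancel]
  have hloc : IsLocalMax (fun z => U z - φ (z.1, a - z.2)) (x, a - t) := by
    have hc : Filter.Tendsto (fun z : RSpace d × ℝ => (z.1, a - z.2)) (𝓝 (x, a - t))
        (𝓝 (x, t)) := by
      have : Continuous fun z : RSpace d × ℝ => (z.1, a - z.2) := by fun_prop
      simpa using this.tendsto (x, a - t)
    have hmem : ∀ᶠ z : RSpace d × ℝ in 𝓝 (x, a - t), z.2 ∈ Ioo 0 a :=
      continuous_snd.continuousAt.eventually_mem (Ioo_mem_nhds ht'.1 ht'.2)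
    filter_upwards [hc.eventually hmax, hmem] with z hz hz2
    change U (z.1, z.2) - _ ≤ _
    rw [hUY z.1 z.2 (Ioo_subset_Icc_self hz2), hUY x (a - t) (Ioo_subset_Icc_self ht'),
      sub_sub_cancel]
    exact hz
  have h := hU _ hψ x (a - t) ht' hloc
  simp only [sub_sub_cancel] at h
  rw [deriv_comp_const_sub (f := fun s => φ (x, s)), sub_sub_cancel] at h
  linarith

/-- Evolving backwards by a convex Hamiltonian and then forwards does not increase the datum. -/
theorem IsBUCViscositySolution.le_initial_of_neg {d : ℕ} {H : RSpace d → RSpace d → ℝ}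
    (hconv : ∀ x : RSpace d, ConvexOn ℝ Set.univ (fun p => H p x)) {L : NNReal}
    (hlip : ∀ x : RSpace d, LipschitzWith L (fun p => H p x))
    (hmod : HasStructureModulus H) {a : ℝ} (ha : 0 < a) {u v : RSpace d → ℝ}
    {U Z : RSpace d × ℝ → ℝ} (hU : IsBUCViscositySolution (fun p x => -H p x) a u U)
    (hUv : ∀ x, U (x, a) = v x) (hZ : IsBUCViscositySolution H a v Z) (x : RSpace d) :
    Z (x, a) ≤ u x := by
  -- Clamping time extends the reversed solution to all times, as the global sup-convolution
  -- requires.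
  let Y : RSpace d × ℝ → ℝ := fun z => U (z.1, projIcc 0 a ha.le (a - z.2))
  obtain ⟨hUc, C, hC⟩ := hU.buc
  obtain ⟨hZc, C', hC'⟩ := hZ.buc
  have hYUC : UniformContinuous Y := by
    rw [← uniformContinuousOn_univ]
    refine hUc.comp (g := U)
      (f := fun z : RSpace d × ℝ => (z.1, (projIcc 0 a ha.le (a - z.2) : ℝ))) ?_
      fun z _ => ⟨mem_univ _, Subtype.coe_prop _⟩
    rw [uniformContinuousOn_univ]
    exact uniformContinuous_fst.prodMk (uniformContinuous_subtype_val.comp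
      ((LipschitzWith.projIcc ha.le).uniformContinuous.comp
        (uniformContinuous_const.sub uniformContinuous_snd)))
  have hYC : ∀ z, |Y z| ≤ C := fun z => hC _ ⟨mem_univ _, Subtype.coe_prop _⟩
  have hY : ∀ y, ∀ t ∈ Icc 0 a, Y (y, t) = U (y, a - t) := by
    intro y t ht
    simp only [Y]
    rw [projIcc_of_mem ha.le ⟨by linarith [ht.2], by linarith [ht.1]⟩]
  -- Six errors `σ`: three at time `θ` (shifting `Z`, shifting `Y`, replacing `Y` by `W`) and the
  -- same three at `a - 2 * θ`; `σ * a` bounds the accumulated defect of `W`.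
  have hmain : ∀ σ : ℝ, 0 < σ → Z (x, a) ≤ u x + σ * (6 + a) := by
    intro σ hσ
    obtain ⟨δ₁, hδ₁, hYδ⟩ := Metric.uniformContinuous_iff.1 hYUC σ hσ
    obtain ⟨δ₂, hδ₂, hZδ⟩ := Metric.uniformContinuousOn_iff.1 hZc σ hσ
    set θ := min (a / 4) (min (δ₁ / 4) (δ₂ / 4)) with hθdef
    have hθ : 0 < θ := by positivity
    have hθa : θ ≤ a / 4 := min_le_left _ _
    have hθ₁ : θ ≤ δ₁ / 4 := (min_le_right _ _).trans (min_le_left _ _)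
    have hθ₂ : θ ≤ δ₂ / 4 := (min_le_right _ _).trans (min_le_right _ _)
    have hdist : ∀ (y : RSpace d) (s t : ℝ), dist (y, s) (y, t) = |s - t| := fun y s t => by
      rw [Prod.dist_eq, dist_self, Real.dist_eq, max_eq_right (abs_nonneg _)]
    have hYt : ∀ y s t, |s - t| ≤ 2 * θ → Y (y, s) ≤ Y (y, t) + σ := fun y s t hst => by
      have h := hYδ (a := (y, s)) (b := (y, t)) (by rw [hdist]; linarith)
      rw [Real.dist_eq] at h
      linarith [(abs_lt.1 h).2]
    have hZt : ∀ y, ∀ s ∈ Icc 0 a, ∀ t ∈ Icc 0 a, |s - t| ≤ 2 * θ →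
        Z (y, s) ≤ Z (y, t) + σ := fun y s hs t ht hst => by
      have h := hZδ (y, s) ⟨mem_univ _, hs⟩ (y, t) ⟨mem_univ _, ht⟩ (by rw [hdist]; linarith)
      rw [Real.dist_eq] at h
      linarith [(abs_lt.1 h).2]
    obtain ⟨W, hW, hWY, hWH⟩ := exists_contDiff_supersolution hconv hlip hmod hYUC hYC
      (fun φ hφ x t ht hmax => hU.sub.le_deriv_of_reverse hY hφ ht hmax) hσ hθ
    have hsub : (univ : Set (RSpace d)) ×ˢ Icc θ (a - θ) ⊆ univ ×ˢ Icc 0 a :=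
      prod_mono_right (Icc_subset_Icc hθ.le (by linarith))
    have hcomp := hZ.sub.le_of_contDiff hlip (κ := σ) (m := 3 * σ) (C := C' + (C + σ)) hθ
      (b := a - θ) (by linarith) hσ.le (hZc.continuousOn.mono hsub)
      (fun z hz => by
        have h1 := (abs_le.1 (hC' z (hsub hz))).2
        have h2 := (abs_le.1 (hWY z)).1
        have h3 := (abs_le.1 (hYC z)).1
        linarith) hW hWH
      (fun y => by
        have h1 := hZt y θ ⟨hθ.le, by linarith⟩ 0 ⟨le_rfl, ha.le⟩
          (by rw [sub_zero, abs_of_pos hθ]; linarith)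
        have h2 := hYt y 0 θ (by rw [zero_sub, abs_neg, abs_of_pos hθ]; linarith)
        have h3 := (abs_le.1 (hWY (y, θ))).1
        have h4 : Y (y, 0) = Z (y, 0) := by
          rw [hY y 0 ⟨le_rfl, ha.le⟩, sub_zero, hUv, hZ.initial]
        linarith) x (t₁ := a - 2 * θ) ⟨by linarith, by linarith⟩
    have habs : |a - (a - 2 * θ)| ≤ 2 * θ := by
      rw [sub_sub_cancel, abs_of_pos (by positivity)]
    have h1 := hZt x a ⟨ha.le, le_rfl⟩ (a - 2 * θ) ⟨by linarith, by linarith⟩ habs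
    have h2 := hYt x (a - 2 * θ) a (by rw [abs_sub_comm]; exact habs)
    have h3 := (abs_le.1 (hWY (x, a - 2 * θ))).2
    have h4 : Y (x, a) = u x := by
      rw [hY x a ⟨ha.le, le_rfl⟩, sub_self, hU.initial]
    have h5 : σ * (a - 2 * θ - θ) ≤ σ * a := by gcongr; linarith
    linarith
  refine le_of_forall_pos_le_add fun ε hε => ?_
  have h := hmain (ε / (6 + a)) (by positivity)
  rwa [div_mul_cancel₀ _ (by positivity)] at h

/-! ### Sign change and the second inequality -/

theorem gradient_fun_neg {F : Type*} [NormedAddCommGroup F] [InnerProductSpace ℝ F]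
    [CompleteSpace F] (f : F → ℝ) (x : F) : gradient (fun y => -f y) x = -gradient f x := by
  rw [gradient, gradient, fderiv_fun_neg, map_neg]

/-- Changing the sign of a solution reflects the Hamiltonian. -/
theorem IsBUCViscositySolution.neg {d : ℕ} {G : RSpace d → RSpace d → ℝ} {a : ℝ}
    {u : RSpace d → ℝ} {U : RSpace d × ℝ → ℝ} (hU : IsBUCViscositySolution G a u U) :
    IsBUCViscositySolution (fun p x => -G (-p) x) a (fun x => -u x) (fun z => -U z) where
  buc := by
    obtain ⟨hc, C, hC⟩ := hU.buc
    exact ⟨uniformContinuous_neg.comp_uniformContinuousOn hc, C, fun z hz => by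
      rw [abs_neg]; exact hC z hz⟩
  sub := by
    intro φ hφ x t ht hmax
    have h := hU.super _ hφ.neg x t ht (by
      refine Filter.Eventually.mono hmax fun z hz => ?_
      simp only at hz ⊢
      linarith)
    rw [gradient_fun_neg, deriv.fun_neg] at h
    linarith
  super := by
    intro φ hφ x t ht hmin
    have h := hU.sub _ hφ.neg x t ht (by
      refine Filter.Eventually.mono hmin fun z hz => ?_
      simp only at hz ⊢
      linarith)
    rw [gradient_fun_neg, deriv.fun_neg] at h
    linarith
  initial x := by rw [hU.initial]

theorem mainTheorem5 (d : ℕ) (H : RSpace d → RSpace d → ℝ)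
    (hconv : ∀ x : RSpace d, ConvexOn ℝ Set.univ (fun p => H p x))
    (hlip : ∃ L : NNReal, ∀ x : RSpace d, LipschitzWith L (fun p => H p x))
    (hmod : HasStructureModulus H)
    (u : RSpace d → ℝ) (hu : IsBUCOn u Set.univ) (a : ℝ) (ha : 0 < a) :
    (∀ v w : RSpace d → ℝ,
      IsSolutionOperatorValue (fun p x => -H p x) a u v → IsSolutionOperatorValue H a v w →
        ∀ x, w x ≤ u x) ∧
    (∀ v w : RSpace d → ℝ,
      IsSolutionOperatorValue H a u v → IsSolutionOperatorValue (fun p x => -H p x) a v w →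
        ∀ x, u x ≤ w x) := by
  obtain ⟨L, hL⟩ := hlip
  constructor
  · rintro v w ⟨U, hU, hUv⟩ ⟨Z, hZ, hZw⟩ x
    rw [← hZw]
    exact hU.le_initial_of_neg hconv hL hmod ha hUv hZ x
  · rintro v w ⟨U, hU, hUv⟩ ⟨Z, hZ, hZw⟩ x
    have hZ' := hZ.neg
    simp only [neg_neg] at hZ'
    -- Negation turns `H` into `-H(-p, x)` and `-H` into `H(-p, x)`, so the order of the two
    -- evolutions is that of the first inequality.
    have h := IsBUCViscositySolution.le_initial_of_neg (H := fun p x => H (-p) x) (L := L)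
      (fun x => (hconv x).comp_linearMap (-LinearMap.id))
      (fun x => LipschitzWith.of_dist_le_mul fun p q => by
        simpa using (hL x).dist_le_mul (-p) (-q))
      (fun ε hε => by
        obtain ⟨δ, hδ, h⟩ := hmod ε hε
        exact ⟨δ, hδ, fun p x y hxy => h (-p) x y (by rwa [norm_neg])⟩)
      ha hU.neg (fun x => by rw [hUv]) hZ' x
    rw [hZw] at h
    linarith
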